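/- Corollary 6.5 (label hanging). A set partition of a finite set $S\subset\mathbb{Z}$ is a set of nonempty, pairwise disjoint blocks with union $S$. A pair $(i,j)$ is an arc of a set partition $\Lambda$ if $i$ and $j$ lie in the same block and $j$ is the least element of that block greater than $i$. Let $\mathrm{Arc}(\Lambda)$ be the set of arcs of $\Lambda$ and $\mathrm{Cov}(\Lambda)$ the set of its arcs of the form $(i,i+1)$. Write $[n]=\{1,\dots,n\}$ and $[\pm n]=\{\pm1,\dots,\pm n\}$. Let $\mathrm{NC}(n)$ be the set of noncrossing partitions of $[n]$, i.e. those with no two arcs $(i,k),(j,l)$ such that $i<j<k<l$. Let $\widetilde{\mathrm{NC}}^{B}(n)$ (respectively $\widetilde{\mathrm{NC}}^{D}(n)$) be the set of partitions $\Lambda$ of $\{0\}\cup[\pm n]$ (respectively of $[\pm n]$) such that: $(i,j)\in\mathrm{Arc}(\Lambda)$ if and only if $(-j,-i)\in\mathrm{Arc}(\Lambda)$; $\Lambda$ has no arc of the form $(-i,i)$; and whenever $(i,k),(j,l)\in\mathrm{Arc}(\Lambda)$ with $i<j<k<l$, then $(i,k)=(-l,-j)$. For such $\Lambda$ the numbers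 $|\mathrm{Arc}(\Lambda)|$ and $|\mathrm{Cov}(\Lambda)|$ are even. For $n\ge 0$ and $X\in\{B,D\}$ define polynomials in $\mathbb{Z}[x,y]$ by $$\mathrm{Cat}_n(x,y)=\sum_{\Lambda\in\mathrm{NC}(n)}x^{|\mathrm{Arc}(\Lambda)\setminus\mathrm{Cov}(\Lambda)|}\,y^{|\mathrm{Cov}(\Lambda)|},\qquad \mathrm{Cat}^{X}_n(x,y)=\sum_{\Lambda\in\widetilde{\mathrm{NC}}^{X}(n)}x^{|\mathrm{Arc}(\Lambda)|/2}\,(y/x)^{|\mathrm{Cov}(\Lambda)|/2}.$$ Then, for every integer $n\ge 0$: (1) $\mathrm{Cat}^{B}_{n+1}(x,y)=(y+1)\,\mathrm{Cat}^{B}_n(x,y)+2nx\,\mathrm{Cat}_n(x,y)$; (2) $\mathrm{Cat}^{D}_{n+1}(x,y)=\mathrm{Cat}^{B}_n(x,y)+nx\,\mathrm{Cat}_n(x,y)$. -/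

import Mathlib

namespace SetPart

/-- The arcs of a set partition of a finite set of integers: the pairs `(i, j)` such that `i` and
`j` lie in a common block and `j` is the least element of that block greater than `i`. -/
def arcs {s : Finset ℤ} (P : Finpartition s) : Finset (ℤ × ℤ) :=
  (s ×ˢ s).filter fun p =>
    p.1 < p.2 ∧ ∃ B ∈ P.parts, p.1 ∈ B ∧ p.2 ∈ B ∧ ∀ m ∈ B, p.1 < m → p.2 ≤ m

/-- The arcs of the form `(i, i + 1)`. -/
def covs {s : Finset ℤ} (P : Finpartition s) : Finset (ℤ × ℤ) :=
  (arcs P).filter fun p => p.2 = p.1 + 1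

/-- Noncrossing set partitions: no two arcs `(i, k)`, `(j, l)` have `i < j < k < l`. -/
def IsNoncrossing {s : Finset ℤ} (P : Finpartition s) : Prop :=
  ∀ p ∈ arcs P, ∀ q ∈ arcs P, ¬ (p.1 < q.1 ∧ q.1 < p.2 ∧ p.2 < q.2)

/-- Set partitions whose arc set is closed under `(i, j) ↦ (-j, -i)` and contains no arc of the
form `(-i, i)`. -/
def IsSymmetric {s : Finset ℤ} (P : Finpartition s) : Prop :=
  ∀ p ∈ arcs P, (-p.2, -p.1) ∈ arcs P ∧ p.1 ≠ -p.2

/-- The weakened noncrossing condition for symmetric partitions: if `(i, k)` and `(j, l)` are arcs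
with `i < j < k < l`, then `(i, k) = (-l, -j)`. -/
def IsSymNoncrossing {s : Finset ℤ} (P : Finpartition s) : Prop :=
  ∀ p ∈ arcs P, ∀ q ∈ arcs P, p.1 < q.1 ∧ q.1 < p.2 ∧ p.2 < q.2 → p = (-q.2, -q.1)

instance {s : Finset ℤ} : DecidablePred (IsNoncrossing (s := s)) :=
  fun P => by unfold IsNoncrossing; infer_instance

instance {s : Finset ℤ} : DecidablePred (IsSymmetric (s := s)) :=
  fun P => by unfold IsSymmetric; infer_instance

instance {s : Finset ℤ} : DecidablePred (IsSymNoncrossing (s := s)) :=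
  fun P => by unfold IsSymNoncrossing; infer_instance

/-- The ground set `[n] = {1, …, n}`. -/
noncomputable def groundA (n : ℕ) : Finset ℤ := Finset.Icc 1 (n : ℤ)

/-- The ground set `{0} ∪ [±n] = {-n, …, n}`. -/
noncomputable def groundB (n : ℕ) : Finset ℤ := Finset.Icc (-(n : ℤ)) (n : ℤ)

/-- The ground set `[±n] = {±1, …, ±n}`. -/
noncomputable def groundD (n : ℕ) : Finset ℤ := (groundB n).erase 0

/-- Noncrossing partitions of `[n]`. -/
noncomputable def ncA (n : ℕ) : Finset (Finpartition (groundA n)) :=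
  Finset.univ.filter fun P => IsNoncrossing P

/-- The type B analogue: symmetric partitions of `{0} ∪ [±n]` with the weakened noncrossing
condition. -/
noncomputable def ncB (n : ℕ) : Finset (Finpartition (groundB n)) :=
  Finset.univ.filter fun P => IsSymmetric P ∧ IsSymNoncrossing P

/-- The type D analogue: symmetric partitions of `[±n]` with the weakened noncrossing
condition. -/
noncomputable def ncD (n : ℕ) : Finset (Finpartition (groundD n)) :=
  Finset.univ.filter fun P => IsSymmetric P ∧ IsSymNoncrossing P

/-- A set of pairs closed under `(i, j) ↦ (-j, -i)` without pairs `(-i, i)` has even size. -/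
theorem even_card_of_symm (S : Finset (ℤ × ℤ))
    (h : ∀ p ∈ S, (-p.2, -p.1) ∈ S ∧ p.1 ≠ -p.2) : Even S.card := by
  have h0 : ∑ _p ∈ S, (1 : ZMod 2) = 0 := by
    refine Finset.sum_involution (fun p _ => (-p.2, -p.1)) ?_ ?_ ?_ ?_
    · intro p _
      decide
    · intro p hp _ he
      exact (h p hp).2 (congrArg Prod.fst he).symm
    · intro p hp
      exact (h p hp).1
    · intro p _
      simp
  rw [Finset.sum_const, nsmul_eq_mul, mul_one] at h0
  exact (ZMod.natCast_eq_zero_iff_even).1 h0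

/-- So the halved exponents used for the polynomials of types B and D below are exact. -/
theorem even_card_covs {s : Finset ℤ} (P : Finpartition s) (h : IsSymmetric P) :
    Even (covs P).card ∧ Even (arcs P \ covs P).card := by
  constructor
  · refine even_card_of_symm _ fun p hp => ?_
    rw [covs, Finset.mem_filter] at hp ⊢
    obtain ⟨h1, h2⟩ := hp
    refine ⟨⟨(h p h1).1, ?_⟩, (h p h1).2⟩
    simp only
    omega
  · refine even_card_of_symm _ fun p hp => ?_
    simp only [covs, Finset.mem_sdiff, Finset.mem_filter, not_and] at hp ⊢
    obtain ⟨h1, h2⟩ := hp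
    refine ⟨⟨(h p h1).1, fun _ => ?_⟩, (h p h1).2⟩
    have := h2 h1
    omega

/-- The polynomial `Cat_n(x, y) = ∑ x ^ |Arc \ Cov| y ^ |Cov|` over noncrossing partitions of
`[n]`, where `x = X 0` and `y = X 1`. -/
noncomputable def cat (n : ℕ) : MvPolynomial (Fin 2) ℤ :=
  ∑ P ∈ ncA n, MvPolynomial.X 0 ^ (arcs P \ covs P).card * MvPolynomial.X 1 ^ (covs P).card

/-- The polynomial `Cat^B_n(x, y) = ∑ x ^ (|Arc| / 2) (y / x) ^ (|Cov| / 2)`, that is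
`∑ x ^ (|Arc \ Cov| / 2) y ^ (|Cov| / 2)`. Both cardinalities are even. -/
noncomputable def catB (n : ℕ) : MvPolynomial (Fin 2) ℤ :=
  ∑ P ∈ ncB n,
    MvPolynomial.X 0 ^ ((arcs P \ covs P).card / 2) * MvPolynomial.X 1 ^ ((covs P).card / 2)

/-- The polynomial `Cat^D_n(x, y)`, given by the same sum over the partitions of type D. -/
noncomputable def catD (n : ℕ) : MvPolynomial (Fin 2) ℤ :=
  ∑ P ∈ ncD n,
    MvPolynomial.X 0 ^ ((arcs P \ covs P).card / 2) * MvPolynomial.X 1 ^ ((covs P).card / 2)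

end SetPart

/-! ### Set partitions as arc sets. -/

namespace SetPart
open Finset

/-! Let T_n(h) be the coefficient of t^h in (t + b + x/t)^n with b = 1 + y (`trinomial`, `tri`). All
three families are expressed by it: Cat_{n+1} = T_n(0) - x T_n(2) (`cat_succ`), Cat^B_n = T_n(0)
(`catB_eq`), Cat^D_{n+1} = T_n(0) + x T_n(1) (`catD_succ`). Applying t d/dt to the power
(`mul_trinomial_succ`) gives n Cat_n = T_n(1), and the symmetry t ↔ x/t gives T_n(-1) = x T_n(1).
Then (1) is the Pascal rule T_{n+1}(0) = T_n(-1) + (1 + y) T_n(0) + x T_n(1), and (2) is immediate.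

The combinatorial input is as follows. A partition is determined by its arcs, so arc sets are
counted instead. A symmetric arc set amounts to a pair (A, H), where A consists of the arcs starting
at a nonnegative number and H of the positive ends of the arcs over 0. The weak noncrossing
condition forces the arcs over 0 to join consecutive elements of H up to sign, so H, of even size,
determines them (`sum_symArcSets`).

Deleting the least point yields a recursion for such pairs by the number h of marked points. It is
that of weighted walks confined to h ≥ 0, and the reflection principle solves it: on m + 1 points,
the first unmarked, the count is T_m(h) - x T_m(h + 2) (`halfSum_eq_tri`). Here h = 0 is type A,
while summing over h of fixed parity telescopes and gives types B and D. -/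

/-- Sets of pairs `i < j` of elements of `s` that are functional in both directions. -/
structure IsArcSet (s : Finset ℤ) (A : Finset (ℤ × ℤ)) : Prop where
  fst_mem : ∀ p ∈ A, p.1 ∈ s
  snd_mem : ∀ p ∈ A, p.2 ∈ s
  lt : ∀ p ∈ A, p.1 < p.2
  fst_inj : ∀ p ∈ A, ∀ q ∈ A, p.1 = q.1 → p = q
  snd_inj : ∀ p ∈ A, ∀ q ∈ A, p.2 = q.2 → p = q

theorem mem_arcs {s : Finset ℤ} {P : Finpartition s} {p : ℤ × ℤ} :
    p ∈ arcs P ↔ p.1 < p.2 ∧ ∃ B ∈ P.parts, p.1 ∈ B ∧ p.2 ∈ B ∧ ∀ m ∈ B, p.1 < m → p.2 ≤ m := by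
  rw [arcs, mem_filter, mem_product]
  refine ⟨fun h => h.2, fun h => ⟨?_, h⟩⟩
  obtain ⟨-, B, hB, h1, h2, -⟩ := h
  exact ⟨P.le hB h1, P.le hB h2⟩

theorem isArcSet_arcs {s : Finset ℤ} (P : Finpartition s) : IsArcSet s (arcs P) where
  fst_mem p hp := (mem_product.1 (mem_filter.1 hp).1).1
  snd_mem p hp := (mem_product.1 (mem_filter.1 hp).1).2
  lt p hp := (mem_arcs.1 hp).1
  fst_inj p hp q hq h := by
    obtain ⟨h1, B, hB, h2, h3, h4⟩ := mem_arcs.1 hp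
    obtain ⟨k1, C, hC, k2, k3, k4⟩ := mem_arcs.1 hq
    obtain rfl : B = C := P.eq_of_mem_parts hB hC h2 (h ▸ k2)
    exact Prod.ext h (le_antisymm (h4 _ k3 (h ▸ k1)) (k4 _ h3 (h ▸ h1)))
  snd_inj p hp q hq h := by
    obtain ⟨h1, B, hB, h2, h3, h4⟩ := mem_arcs.1 hp
    obtain ⟨k1, C, hC, k2, k3, k4⟩ := mem_arcs.1 hq
    obtain rfl : B = C := P.eq_of_mem_parts hB hC h3 (h ▸ k3)
    refine Prod.ext ?_ h
    rcases lt_trichotomy p.1 q.1 with hlt | heq | hlt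
    · have := h4 _ k2 hlt
      omega
    · exact heq
    · have := k4 _ h2 hlt
      omega

/-- The relation `i → j` given by a set of pairs. -/
def ArcRel (A : Finset (ℤ × ℤ)) (i j : ℤ) : Prop := (i, j) ∈ A

theorem IsArcSet.le_of_reach {s : Finset ℤ} {A : Finset (ℤ × ℤ)} (hA : IsArcSet s A) {i j : ℤ}
    (h : Relation.ReflTransGen (ArcRel A) i j) : i ≤ j := by
  induction h with
  | refl => exact le_rfl
  | tail _ h ih => exact ih.trans (hA.lt _ h).le

theorem reach_of_mem_part {s : Finset ℤ} (P : Finpartition s) {B : Finset ℤ} (hB : B ∈ P.parts)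
    {i j : ℤ} (hi : i ∈ B) (hj : j ∈ B) (hij : i ≤ j) :
    Relation.ReflTransGen (ArcRel (arcs P)) i j := by
  obtain rfl | hlt := hij.eq_or_lt
  · exact .refl
  have hne : (B.filter fun m => i < m).Nonempty := ⟨j, mem_filter.2 ⟨hj, hlt⟩⟩
  set m := (B.filter fun m => i < m).min' hne with hm
  have hmB : m ∈ B ∧ i < m := mem_filter.1 (min'_mem _ hne)
  have hmj : m ≤ j := min'_le _ _ (mem_filter.2 ⟨hj, hlt⟩)
  have harc : ArcRel (arcs P) i m :=
    mem_arcs.2 ⟨hmB.2, B, hB, hi, hmB.1, fun k hk hik => min'_le _ _ (mem_filter.2 ⟨hk, hik⟩)⟩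
  exact .head harc (reach_of_mem_part P hB hmB.1 hj hmj)
termination_by (j - i).toNat
decreasing_by omega

theorem exists_part_of_reach {s : Finset ℤ} (P : Finpartition s) {i j : ℤ} (hi : i ∈ s)
    (h : Relation.ReflTransGen (ArcRel (arcs P)) i j) : ∃ B ∈ P.parts, i ∈ B ∧ j ∈ B := by
  induction h with
  | refl =>
    obtain ⟨B, hB, h⟩ := P.exists_mem hi
    exact ⟨B, hB, h, h⟩
  | tail _ h ih =>
    obtain ⟨B, hB, h1, h2⟩ := ih
    obtain ⟨-, C, hC, h3, h4, -⟩ := mem_arcs.1 h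
    obtain rfl : B = C := P.eq_of_mem_parts hB hC h2 h3
    exact ⟨B, hB, h1, h4⟩

theorem parts_subset_of_arcs_eq {s : Finset ℤ} {P Q : Finpartition s} (h : arcs P = arcs Q) :
    P.parts ⊆ Q.parts := by
  have key : ∀ {P Q : Finpartition s}, arcs P = arcs Q → ∀ {B C : Finset ℤ}, B ∈ P.parts →
      C ∈ Q.parts → ∀ {i : ℤ}, i ∈ B → i ∈ C → B ⊆ C := by
    intro P Q h B C hB hC i hiB hiC j hj
    rcases le_total i j with hij | hij
    · have h1 := reach_of_mem_part P hB hiB hj hij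
      rw [h] at h1
      obtain ⟨D, hD, h2, h3⟩ := exists_part_of_reach Q (Q.le hC hiC) h1
      obtain rfl := Q.eq_of_mem_parts hC hD hiC h2
      exact h3
    · have h1 := reach_of_mem_part P hB hj hiB hij
      rw [h] at h1
      obtain ⟨D, hD, h2, h3⟩ := exists_part_of_reach Q (P.le hB hj) h1
      obtain rfl := Q.eq_of_mem_parts hC hD hiC h3
      exact h2
  intro B hB
  obtain ⟨i, hi⟩ := P.nonempty_of_mem_parts hB
  obtain ⟨C, hC, hiC⟩ := Q.exists_mem (P.le hB hi)
  rwa [(key h hB hC hi hiC).antisymm (key h.symm hC hB hiC hi)]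

theorem arcs_injective (s : Finset ℤ) : Function.Injective (arcs (s := s)) := fun _ _ h =>
  Finpartition.ext ((parts_subset_of_arcs_eq h).antisymm (parts_subset_of_arcs_eq h.symm))

/-- With at most one arc leaving and one entering each point, the digraph is a disjoint union of
increasing chains; these chains are the blocks. -/
theorem IsArcSet.exists_arcs_eq {s : Finset ℤ} {A : Finset (ℤ × ℤ)} (hA : IsArcSet s A) :
    ∃ P : Finpartition s, arcs P = A := by
  classical
  let R := Relation.ReflTransGen (ArcRel A)
  have hr : Relator.RightUnique (ArcRel A) := fun i j k h1 h2 =>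
    congrArg Prod.snd (hA.fst_inj _ h1 _ h2 rfl)
  have hl : Relator.RightUnique (Function.swap (ArcRel A)) := fun i j k h1 h2 =>
    congrArg Prod.fst (hA.snd_inj _ h1 _ h2 rfl)
  have total_out : ∀ {i j k}, R i j → R i k → R j k ∨ R k j := fun h1 h2 =>
    Relation.ReflTransGen.total_of_right_unique hr h1 h2
  have total_in : ∀ {i j k}, R j i → R k i → R j k ∨ R k j := fun h1 h2 => by
    have := Relation.ReflTransGen.total_of_right_unique hl
      (Relation.reflTransGen_swap.2 h1) (Relation.reflTransGen_swap.2 h2)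
    exact this.symm.imp Relation.reflTransGen_swap.1 Relation.reflTransGen_swap.1
  -- Transitivity is where both kinds of functionality enter: two points reached from, or reaching,
  -- a common point are comparable.
  let S : Setoid ℤ :=
    { r := fun i j => R i j ∨ R j i
      iseqv :=
        { refl := fun i => .inl .refl
          symm := fun h => h.symm
          trans := by
            rintro i j k (h1 | h1) (h2 | h2)
            · exact .inl (h1.trans h2)
            · exact total_in h1 h2
            · exact total_out h1 h2
            · exact .inr (h2.trans h1) } }
  have step : ∀ {i m}, R i m → i < m → ∃ j, (i, j) ∈ A ∧ R j m := fun {i m} h hlt => by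
    rcases Relation.ReflTransGen.cases_head h with rfl | ⟨j, h1, h2⟩
    · exact absurd hlt (lt_irrefl _)
    · exact ⟨j, h1, h2⟩
  have up : ∀ {i m}, (R i m ∨ R m i) → i < m → R i m := fun {i m} h hlt =>
    h.resolve_right fun h => by have := hA.le_of_reach h; omega
  let P : Finpartition s := Finpartition.ofSetSetoid S s
  have hP : ∀ B, B ∈ P.parts ↔ ∃ i ∈ s, (s.filter fun j => S.r i j) = B := by
    intro B
    simp only [P, Finpartition.ofSetSetoid, mem_image]
  refine ⟨P, ?_⟩
  ext ⟨i, j⟩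
  rw [mem_arcs]
  constructor
  · rintro ⟨hlt, B, hB, h1, h2, h3⟩
    obtain ⟨r, hr, rfl⟩ := (hP B).1 hB
    simp only [mem_filter] at h1 h2 h3 hlt
    have hR : R i j := up (S.iseqv.trans (S.iseqv.symm h1.2) h2.2) hlt
    obtain ⟨k, hk, hkj⟩ := step hR hlt
    have := h3 k ⟨hA.snd_mem _ hk, S.iseqv.trans h1.2 (.inl (.single hk))⟩ (hA.lt _ hk)
    have := hA.le_of_reach hkj
    obtain rfl : k = j := by omega
    exact hk
  · intro h
    refine ⟨hA.lt _ h, _, (hP _).2 ⟨i, hA.fst_mem _ h, rfl⟩, ?_, ?_, ?_⟩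
    · exact mem_filter.2 ⟨hA.fst_mem _ h, .inl .refl⟩
    · exact mem_filter.2 ⟨hA.snd_mem _ h, .inl (.single h)⟩
    · intro m hm hlt
      obtain ⟨k, hk, hkm⟩ := step (up (mem_filter.1 hm).2 hlt) hlt
      rw [show j = k from congrArg Prod.snd (hA.fst_inj _ h _ hk rfl)]
      exact hA.le_of_reach hkm

open scoped Classical in
/-- The arc sets on `s`. -/
noncomputable def arcSets (s : Finset ℤ) : Finset (Finset (ℤ × ℤ)) :=
  (s ×ˢ s).powerset.filter fun A => IsArcSet s A

theorem mem_arcSets {s : Finset ℤ} {A : Finset (ℤ × ℤ)} : A ∈ arcSets s ↔ IsArcSet s A := by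
  simp only [arcSets, mem_filter, mem_powerset]
  exact ⟨fun h => h.2, fun h => ⟨fun p hp => mem_product.2 ⟨h.fst_mem p hp, h.snd_mem p hp⟩, h⟩⟩

/-- The monomial `x ^ |A \ Cov| * y ^ |Cov|` of a set of arcs. -/
noncomputable def weight (A : Finset (ℤ × ℤ)) : MvPolynomial (Fin 2) ℤ :=
  MvPolynomial.X 0 ^ (A \ A.filter fun p => p.2 = p.1 + 1).card *
    MvPolynomial.X 1 ^ (A.filter fun p => p.2 = p.1 + 1).card

theorem sum_finpartition {M : Type*} [AddCommMonoid M] (s : Finset ℤ)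
    (φ : Finset (ℤ × ℤ) → Prop) [DecidablePred φ] (f : Finset (ℤ × ℤ) → M) :
    ∑ P ∈ univ.filter (fun P : Finpartition s => φ (arcs P)), f (arcs P) =
      ∑ A ∈ (arcSets s).filter φ, f A := by
  refine sum_bij (fun P _ => arcs P) ?_ ?_ ?_ ?_
  · intro P hP
    exact mem_filter.2 ⟨mem_arcSets.2 (isArcSet_arcs P), (mem_filter.1 hP).2⟩
  · intro P _ Q _ h
    exact arcs_injective s h
  · intro A hA
    obtain ⟨h1, h2⟩ := mem_filter.1 hA
    obtain ⟨P, rfl⟩ := (mem_arcSets.1 h1).exists_arcs_eq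
    exact ⟨P, mem_filter.2 ⟨mem_univ _, h2⟩, rfl⟩
  · intro P _
    rfl

end SetPart

/-! ### Noncrossing arc sets with marked points, and their recursion. -/

namespace SetPart
open Finset

/-- A noncrossing arc set `z.1` on `[a, n]` with a set `z.2` of points, none of which is the end
of an arc or lies under an arc. -/
structure IsHalf (a n : ℤ) (z : Finset (ℤ × ℤ) × Finset ℤ) : Prop where
  arcSet : IsArcSet (Icc a n) z.1
  noncrossing : ∀ p ∈ z.1, ∀ q ∈ z.1, ¬ (p.1 < q.1 ∧ q.1 < p.2 ∧ p.2 < q.2)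
  subset : z.2 ⊆ Icc a n
  end_ne : ∀ c ∈ z.2, ∀ p ∈ z.1, p.2 ≠ c
  not_under : ∀ c ∈ z.2, ∀ p ∈ z.1, ¬ (p.1 < c ∧ c < p.2)

open scoped Classical in
/-- All pairs satisfying `IsHalf a n`. -/
noncomputable def halves (a n : ℤ) : Finset (Finset (ℤ × ℤ) × Finset ℤ) :=
  (arcSets (Icc a n) ×ˢ (Icc a n).powerset).filter fun z => IsHalf a n z

theorem mem_halves {a n : ℤ} {z : Finset (ℤ × ℤ) × Finset ℤ} : z ∈ halves a n ↔ IsHalf a n z := by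
  simp only [halves, mem_filter, mem_product, mem_powerset, mem_arcSets]
  exact ⟨fun h => h.2, fun h => ⟨⟨h.arcSet, h.subset⟩, h⟩⟩

namespace IsHalf

variable {a n j : ℤ} {A : Finset (ℤ × ℤ)} {H : Finset ℤ}

theorem le_fst (h : IsHalf a n (A, H)) {p : ℤ × ℤ} (hp : p ∈ A) : a ≤ p.1 :=
  (mem_Icc.1 (h.arcSet.fst_mem p hp)).1

theorem snd_le (h : IsHalf a n (A, H)) {p : ℤ × ℤ} (hp : p ∈ A) : p.2 ≤ n :=
  (mem_Icc.1 (h.arcSet.snd_mem p hp)).2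

theorem lt (h : IsHalf a n (A, H)) {p : ℤ × ℤ} (hp : p ∈ A) : p.1 < p.2 := h.arcSet.lt p hp

theorem bounds (h : IsHalf a n (A, H)) {c : ℤ} (hc : c ∈ H) : a ≤ c ∧ c ≤ n :=
  mem_Icc.1 (h.subset hc)

theorem extend (h : IsHalf (a + 1) n (A, H)) : IsHalf a n (A, H) where
  arcSet :=
    { h.arcSet with
      fst_mem := fun p hp => Icc_subset_Icc_left (by omega) (h.arcSet.fst_mem p hp)
      snd_mem := fun p hp => Icc_subset_Icc_left (by omega) (h.arcSet.snd_mem p hp) }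
  noncrossing := h.noncrossing
  subset := h.subset.trans (Icc_subset_Icc_left (by omega))
  end_ne := h.end_ne
  not_under := h.not_under

theorem restrict (h : IsHalf a n (A, H)) (ha : a ∉ H) (hA : ∀ p ∈ A, p.1 ≠ a) :
    IsHalf (a + 1) n (A, H) where
  arcSet :=
    { h.arcSet with
      fst_mem := fun p hp => by
        have := h.le_fst hp
        have := h.snd_le hp
        have := h.lt hp
        have := hA p hp
        exact mem_Icc.2 (by omega)
      snd_mem := fun p hp => by
        have := h.le_fst hp
        have := h.snd_le hp
        have := h.lt hp
        exact mem_Icc.2 (by omega) }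
  noncrossing := h.noncrossing
  subset c hc := by
    have := h.bounds hc
    have : c ≠ a := fun e => ha (e ▸ hc)
    exact mem_Icc.2 (by omega)
  end_ne := h.end_ne
  not_under := h.not_under

/-- No arc passes over the marked point `j`, so the new arc crosses nothing; minimality of `j` keeps
the other marked points from lying under it. -/
theorem hook (h : IsHalf (a + 1) n (A, H)) (hj : j ∈ H) (hmin : ∀ c ∈ H, j ≤ c) :
    IsHalf a n (insert (a, j) A, H.erase j) := by
  have hjb := h.bounds hj
  have hend : ∀ p ∈ A, p.2 ≠ j := fun p hp => h.end_ne j hj p hp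
  have hunder : ∀ p ∈ A, ¬ (p.1 < j ∧ j < p.2) := fun p hp => h.not_under j hj p hp
  refine ⟨⟨?_, ?_, ?_, ?_, ?_⟩, ?_, ?_, ?_, ?_⟩
  · intro p hp
    rcases mem_insert.1 hp with rfl | hp
    · exact mem_Icc.2 (by simp only; omega)
    · have := h.le_fst hp
      have := h.snd_le hp
      have := h.lt hp
      exact mem_Icc.2 (by omega)
  · intro p hp
    rcases mem_insert.1 hp with rfl | hp
    · exact mem_Icc.2 (by simp only; omega)
    · have := h.le_fst hp
      have := h.snd_le hp
      have := h.lt hp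
      exact mem_Icc.2 (by omega)
  · intro p hp
    rcases mem_insert.1 hp with rfl | hp
    · simp only; omega
    · exact h.lt hp
  · intro p hp q hq hpq
    rcases mem_insert.1 hp with rfl | hp <;> rcases mem_insert.1 hq with rfl | hq
    · rfl
    · have := h.le_fst hq
      simp only at hpq; omega
    · have := h.le_fst hp
      simp only at hpq; omega
    · exact h.arcSet.fst_inj p hp q hq hpq
  · intro p hp q hq hpq
    rcases mem_insert.1 hp with rfl | hp <;> rcases mem_insert.1 hq with rfl | hq
    · rfl
    · exact absurd hpq.symm (hend q hq)
    · exact absurd hpq (hend p hp)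
    · exact h.arcSet.snd_inj p hp q hq hpq
  · intro p hp q hq
    rcases mem_insert.1 hp with rfl | hp <;> rcases mem_insert.1 hq with rfl | hq
    · simp only; omega
    · have := hunder q hq
      simp only; omega
    · have := h.le_fst hp
      simp only; omega
    · exact h.noncrossing p hp q hq
  · intro c hc
    have := h.bounds (mem_of_mem_erase hc)
    exact mem_Icc.2 (by omega)
  · intro c hc p hp
    rcases mem_insert.1 hp with rfl | hp
    · exact (ne_of_mem_erase hc).symm
    · exact h.end_ne c (mem_of_mem_erase hc) p hp
  · intro c hc p hp
    rcases mem_insert.1 hp with rfl | hp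
    · have := hmin c (mem_of_mem_erase hc)
      simp only; omega
    · exact h.not_under c (mem_of_mem_erase hc) p hp

/-- Inverse of `hook`. An arc over `j` would cross `(a, j)`, and a marked point before `j` would lie
under it, so `j` may be marked and is then the least marked point. -/
theorem unhook (h : IsHalf a n (A, H)) (ha : a ∉ H) (hj : (a, j) ∈ A) :
    j ∉ H ∧ (∀ c ∈ H, j ≤ c) ∧ IsHalf (a + 1) n (A.erase (a, j), insert j H) := by
  have hjH : j ∉ H := fun hc => h.end_ne j hc _ hj rfl
  have hne : ∀ p ∈ A.erase (a, j), p ∈ A ∧ p.1 ≠ a ∧ p.2 ≠ j := fun p hp => by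
    obtain ⟨h1, h2⟩ := mem_erase.1 hp
    exact ⟨h2, fun e => h1 (h.arcSet.fst_inj p h2 _ hj e),
      fun e => h1 (h.arcSet.snd_inj p h2 _ hj e)⟩
  have hjlt := h.lt hj
  have hjle := h.snd_le hj
  simp only at hjlt hjle
  refine ⟨hjH, fun c hc => ?_, ⟨⟨?_, ?_, ?_, ?_, ?_⟩, ?_, ?_, ?_, ?_⟩⟩
  · have h1 := h.not_under c hc _ hj
    have h2 := h.bounds hc
    have h3 : c ≠ a := fun e => ha (e ▸ hc)
    simp only at h1
    omega
  · intro p hp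
    obtain ⟨h1, h2, h3⟩ := hne p hp
    have := h.le_fst h1
    have := h.snd_le h1
    have := h.lt h1
    exact mem_Icc.2 (by omega)
  · intro p hp
    obtain ⟨h1, h2, h3⟩ := hne p hp
    have := h.le_fst h1
    have := h.snd_le h1
    have := h.lt h1
    exact mem_Icc.2 (by omega)
  · exact fun p hp => h.lt (hne p hp).1
  · exact fun p hp q hq => h.arcSet.fst_inj p (hne p hp).1 q (hne q hq).1
  · exact fun p hp q hq => h.arcSet.snd_inj p (hne p hp).1 q (hne q hq).1
  · exact fun p hp q hq => h.noncrossing p (hne p hp).1 q (hne q hq).1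
  · intro c hc
    rcases mem_insert.1 hc with rfl | hc
    · exact mem_Icc.2 (by omega)
    · have := h.bounds hc
      have : c ≠ a := fun e => ha (e ▸ hc)
      exact mem_Icc.2 (by omega)
  · intro c hc p hp
    rcases mem_insert.1 hc with rfl | hc
    · exact (hne p hp).2.2
    · exact h.end_ne c hc p (hne p hp).1
  · intro c hc p hp
    obtain ⟨h1, h2, h3⟩ := hne p hp
    rcases mem_insert.1 hc with rfl | hc
    · have := h.noncrossing _ hj p h1
      have := h.le_fst h1
      simp only at *
      omega
    · exact h.not_under c hc p h1

theorem insert_left (h : IsHalf a n (A, H)) (han : a ≤ n) : IsHalf a n (A, insert a H) where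
  arcSet := h.arcSet
  noncrossing := h.noncrossing
  subset := insert_subset (mem_Icc.2 ⟨le_rfl, han⟩) h.subset
  end_ne c hc p hp := by
    rcases mem_insert.1 hc with rfl | hc
    · have := h.le_fst hp
      have := h.lt hp
      omega
    · exact h.end_ne c hc p hp
  not_under c hc p hp := by
    rcases mem_insert.1 hc with rfl | hc
    · have := h.le_fst hp
      omega
    · exact h.not_under c hc p hp

theorem erase_left (h : IsHalf a n (A, H)) : IsHalf a n (A, H.erase a) where
  arcSet := h.arcSet
  noncrossing := h.noncrossing
  subset := (erase_subset _ _).trans h.subset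
  end_ne c hc := h.end_ne c (mem_of_mem_erase hc)
  not_under c hc := h.not_under c (mem_of_mem_erase hc)

end IsHalf

theorem weight_insert {A : Finset (ℤ × ℤ)} {i j : ℤ} (h : (i, j) ∉ A) :
    weight (insert (i, j) A) =
      (if j = i + 1 then MvPolynomial.X 1 else MvPolynomial.X 0) * weight A := by
  simp only [weight, ← filter_not]
  rw [filter_insert, filter_insert]
  by_cases hij : j = i + 1
  · rw [if_pos hij, if_pos hij, if_neg (by simpa using hij),
      card_insert_of_notMem (fun hm => h (mem_filter.1 hm).1)]
    ring
  · rw [if_neg hij, if_neg hij, if_pos (by simpa using hij),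
      card_insert_of_notMem (fun hm => h (mem_filter.1 hm).1)]
    ring

/-- The first point can be marked or unmarked freely, since no arc ends at it or passes over it. -/
theorem sum_halves_mem {M : Type*} [AddCommMonoid M] {a n : ℤ} (han : a ≤ n)
    (f : Finset (ℤ × ℤ) × Finset ℤ → M) :
    ∑ z ∈ (halves a n).filter (fun z => a ∈ z.2), f z =
      ∑ z ∈ (halves a n).filter (fun z => a ∉ z.2), f (z.1, insert a z.2) := by
  symm
  refine sum_bij' (fun z _ => (z.1, insert a z.2)) (fun z _ => (z.1, z.2.erase a)) ?_ ?_ ?_ ?_ ?_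
  · intro z hz
    obtain ⟨h1, h2⟩ := mem_filter.1 hz
    exact mem_filter.2 ⟨mem_halves.2 ((mem_halves.1 h1).insert_left han), mem_insert_self _ _⟩
  · intro z hz
    obtain ⟨h1, h2⟩ := mem_filter.1 hz
    exact mem_filter.2 ⟨mem_halves.2 (mem_halves.1 h1).erase_left, notMem_erase _ _⟩
  · intro z hz
    exact Prod.ext rfl (erase_insert (mem_filter.1 hz).2)
  · intro z hz
    exact Prod.ext rfl (insert_erase (mem_filter.1 hz).2)
  · intro z _
    rfl

/-- The weighted count of the half structures with `h` marked points, the first point of the ground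
set not being marked. -/
noncomputable def halfSum (a n : ℤ) (h : ℕ) : MvPolynomial (Fin 2) ℤ :=
  ∑ z ∈ (halves a n).filter (fun z => a ∉ z.2), if z.2.card = h then weight z.1 else 0

/-- The weighted count of the half structures with `h` marked points, one of them the first point
of the ground set. -/
noncomputable def halfSumMem (a n : ℤ) (h : ℕ) : MvPolynomial (Fin 2) ℤ :=
  ∑ z ∈ (halves a n).filter (fun z => a ∈ z.2), if z.2.card = h then weight z.1 else 0

theorem halfSumMem_zero (a n : ℤ) : halfSumMem a n 0 = 0 := by
  refine sum_eq_zero fun z hz => if_neg ?_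
  rw [card_eq_zero]
  exact ne_empty_of_mem (mem_filter.1 hz).2

theorem halfSumMem_succ {a n : ℤ} (han : a ≤ n) (h : ℕ) :
    halfSumMem a n (h + 1) = halfSum a n h := by
  rw [halfSumMem, sum_halves_mem han, halfSum]
  refine sum_congr rfl fun z hz => ?_
  simp only [card_insert_of_notMem (mem_filter.1 hz).2, add_left_inj]

theorem sum_halves_not_opener (a n : ℤ) (h : ℕ) :
    (∑ z ∈ ((halves a n).filter (fun z => a ∉ z.2)).filter (fun z => ∀ p ∈ z.1, p.1 ≠ a),
      if z.2.card = h then weight z.1 else 0) =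
      halfSum (a + 1) n h + halfSumMem (a + 1) n h := by
  rw [halfSum, halfSumMem, add_comm, sum_filter_add_sum_filter_not]
  refine sum_congr ?_ fun _ _ => rfl
  ext z
  simp only [mem_filter, mem_halves]
  constructor
  · rintro ⟨⟨h1, h2⟩, h3⟩
    exact h1.restrict h2 h3
  · intro h1
    refine ⟨⟨h1.extend, fun hm => ?_⟩, fun p hp e => ?_⟩
    · have := h1.bounds hm
      omega
    · have := h1.le_fst hp
      omega

/-- Trading the arc that starts at `a` for a mark on its end is a bijection, by `hook` and `unhook`.
The removed arc is a cover exactly when the least marked point is `a + 1`, that is, when `a + 1` is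
marked. -/
theorem sum_halves_opener (a n : ℤ) (h : ℕ) :
    (∑ z ∈ ((halves a n).filter (fun z => a ∉ z.2)).filter (fun z => ¬ ∀ p ∈ z.1, p.1 ≠ a),
      if z.2.card = h then weight z.1 else 0) =
      MvPolynomial.X 0 * halfSum (a + 1) n (h + 1) +
        MvPolynomial.X 1 * halfSumMem (a + 1) n (h + 1) := by
  have hR : MvPolynomial.X 0 * halfSum (a + 1) n (h + 1) +
      MvPolynomial.X 1 * halfSumMem (a + 1) n (h + 1) =
      ∑ z ∈ (halves (a + 1) n).filter (fun z => z.2.card = h + 1),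
        (if a + 1 ∈ z.2 then MvPolynomial.X 1 else MvPolynomial.X 0) * weight z.1 := by
    rw [halfSum, halfSumMem, mul_sum, mul_sum, sum_filter, sum_filter, sum_filter,
      ← sum_add_distrib]
    refine sum_congr rfl fun z _ => ?_
    by_cases h1 : a + 1 ∈ z.2 <;> by_cases h2 : z.2.card = h + 1 <;> simp [h1, h2]
  rw [hR, ← sum_filter]
  symm
  have hne : ∀ z ∈ (halves (a + 1) n).filter (fun z => z.2.card = h + 1), z.2.Nonempty := by
    intro z hz
    have := (mem_filter.1 hz).2
    exact card_pos.1 (by omega)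
  have hnot : ∀ z ∈ (halves (a + 1) n).filter (fun z => z.2.card = h + 1), ∀ j, (a, j) ∉ z.1 := by
    intro z hz j hj
    have := (mem_halves.1 (mem_filter.1 hz).1).le_fst hj
    simp only at this
    omega
  refine sum_bij
    (fun z hz => (insert (a, z.2.min' (hne z hz)) z.1, z.2.erase (z.2.min' (hne z hz)))) ?_ ?_ ?_ ?_
  · intro z hz
    obtain ⟨h1, h2⟩ := mem_filter.1 hz
    have h3 := min'_mem _ (hne z hz)
    simp only [mem_filter, mem_halves]
    refine ⟨⟨⟨(mem_halves.1 h1).hook h3 fun c hc => min'_le _ _ hc, fun hm => ?_⟩, fun hall => ?_⟩, ?_⟩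
    · have := (mem_halves.1 h1).bounds (mem_of_mem_erase hm)
      omega
    · exact hall _ (mem_insert_self _ _) rfl
    · rw [card_erase_of_mem h3, h2]
      rfl
  · intro z hz w hw hzw
    obtain ⟨h1, h2⟩ := Prod.mk.inj hzw
    have hz0 := hnot z hz
    have hw0 := hnot w hw
    have hmz := min'_mem _ (hne z hz)
    have hmw := min'_mem _ (hne w hw)
    generalize z.2.min' (hne z hz) = i at h1 h2 hmz
    generalize w.2.min' (hne w hw) = j at h1 h2 hmw
    -- Only the added arc starts at `a`, so the image reveals the least marked point.
    have hij : i = j := by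
      have hm : (a, i) ∈ insert (a, j) w.1 := h1 ▸ mem_insert_self _ _
      rcases mem_insert.1 hm with hm | hm
      · exact congrArg Prod.snd hm
      · exact absurd hm (hw0 i)
    subst hij
    refine Prod.ext ?_ ?_
    · rw [← erase_insert (hz0 i), h1, erase_insert (hw0 i)]
    · rw [← insert_erase hmz, h2, insert_erase hmw]
  · intro z hz
    simp only [mem_filter, mem_halves, not_forall, not_not] at hz
    obtain ⟨⟨⟨h1, h2⟩, ⟨i, j⟩, h3, rfl⟩, h4⟩ := hz
    simp only at h1 h2 h3 h4
    obtain ⟨h5, h6, h7⟩ := h1.unhook h2 h3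
    have hmem : (z.1.erase (i, j), insert j z.2) ∈
        (halves (i + 1) n).filter (fun z => z.2.card = h + 1) :=
      mem_filter.2 ⟨mem_halves.2 h7, by rw [card_insert_of_notMem h5, h4]⟩
    have hmin : (insert j z.2).min' (hne _ hmem) = j := by
      refine le_antisymm (min'_le _ _ (mem_insert_self _ _)) (le_min' _ _ _ fun c hc => ?_)
      rcases mem_insert.1 hc with rfl | hc
      · exact le_rfl
      · exact h6 c hc
    refine ⟨_, hmem, ?_⟩
    simp only [hmin]
    exact Prod.ext (insert_erase h3) (erase_insert h5)
  · intro z hz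
    simp only
    rw [weight_insert (hnot z hz _)]
    congr 1
    refine if_congr ⟨fun hm => ?_, fun hm => ?_⟩ rfl rfl
    · refine le_antisymm (min'_le _ _ hm) ?_
      exact ((mem_halves.1 (mem_filter.1 hz).1).bounds (min'_mem _ (hne z hz))).1
    · rw [← hm]
      exact min'_mem _ _

theorem halfSum_eq (a n : ℤ) (h : ℕ) :
    halfSum a n h = halfSum (a + 1) n h + halfSumMem (a + 1) n h +
      (MvPolynomial.X 0 * halfSum (a + 1) n (h + 1) +
        MvPolynomial.X 1 * halfSumMem (a + 1) n (h + 1)) := by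
  classical
  rw [← sum_halves_not_opener, ← sum_halves_opener, sum_filter_add_sum_filter_not, halfSum]

theorem halfSum_self (n : ℤ) (h : ℕ) : halfSum n n h = if h = 0 then 1 else 0 := by
  have : (halves n n).filter (fun z => n ∉ z.2) = {(∅, ∅)} := by
    ext ⟨A, H⟩
    simp only [mem_filter, mem_halves, mem_singleton, Prod.mk.injEq]
    constructor
    · rintro ⟨h1, h2⟩
      refine ⟨eq_empty_of_forall_notMem fun p hp => ?_, eq_empty_of_forall_notMem fun c hc => ?_⟩
      · have := h1.le_fst hp
        have := h1.snd_le hp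
        have := h1.lt hp
        omega
      · have := h1.bounds hc
        obtain rfl : c = n := by omega
        exact h2 hc
    · rintro ⟨rfl, rfl⟩
      exact ⟨⟨⟨by simp, by simp, by simp, by simp, by simp⟩, by simp, by simp, by simp, by simp⟩,
        by simp⟩
  rw [halfSum, this, sum_singleton]
  simp [weight, eq_comm]

theorem halfSum_succ_zero {a n : ℤ} (han : a + 1 ≤ n) :
    halfSum a n 0 = (1 + MvPolynomial.X 1) * halfSum (a + 1) n 0 +
      MvPolynomial.X 0 * halfSum (a + 1) n 1 := by
  rw [halfSum_eq, halfSumMem_zero, halfSumMem_succ han]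
  ring

theorem halfSum_succ_succ {a n : ℤ} (han : a + 1 ≤ n) (h : ℕ) :
    halfSum a n (h + 1) = halfSum (a + 1) n h + (1 + MvPolynomial.X 1) * halfSum (a + 1) n (h + 1) +
      MvPolynomial.X 0 * halfSum (a + 1) n (h + 2) := by
  rw [halfSum_eq, halfSumMem_succ han, halfSumMem_succ han]
  ring

end SetPart

/-! ### Pairing consecutive elements, and folding symmetric arc sets. -/

namespace SetPart
open Finset

theorem even_card_of_involution {s : Finset ℤ} (f : ℤ → ℤ)
    (h : ∀ c ∈ s, f c ∈ s ∧ f (f c) = c ∧ f c ≠ c) : Even s.card := by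
  have h0 : ∑ _p ∈ s, (1 : ZMod 2) = 0 := by
    refine sum_involution (fun c _ => f c) ?_ ?_ ?_ ?_
    · intro p _
      decide
    · intro c hc _
      exact (h c hc).2.2
    · intro c hc
      exact (h c hc).1
    · intro c hc
      exact (h c hc).2.1
  rw [sum_const, nsmul_eq_mul, mul_one] at h0
  exact ZMod.natCast_eq_zero_iff_even.1 h0

/-- The number of elements of `H` less than `c`. -/
def rank (H : Finset ℤ) (c : ℤ) : ℕ := (H.filter fun x => x < c).card

theorem rank_lt {H : Finset ℤ} {c d : ℤ} (hc : c ∈ H) (h : c < d) : rank H c < rank H d := by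
  refine card_lt_card ⟨fun x hx => ?_, fun hs => ?_⟩
  · obtain ⟨h1, h2⟩ := mem_filter.1 hx
    exact mem_filter.2 ⟨h1, h2.trans h⟩
  · exact lt_irrefl c (mem_filter.1 (hs (mem_filter.2 ⟨hc, h⟩))).2

theorem rank_inj {H : Finset ℤ} {c d : ℤ} (hc : c ∈ H) (hd : d ∈ H) (h : rank H c = rank H d) :
    c = d := by
  rcases lt_trichotomy c d with h1 | h1 | h1
  · exact absurd h (rank_lt hc h1).ne
  · exact h1
  · exact absurd h (rank_lt hd h1).ne'

theorem rank_lt_card {H : Finset ℤ} {c : ℤ} (hc : c ∈ H) : rank H c < H.card :=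
  card_lt_card (filter_ssubset.2 ⟨c, hc, lt_irrefl c⟩)

theorem exists_rank_eq (H : Finset ℤ) {r : ℕ} (hr : r < H.card) : ∃ c ∈ H, rank H c = r := by
  have h : H.image (rank H) = range H.card := by
    refine eq_of_subset_of_card_le (fun r hr => ?_) ?_
    · obtain ⟨c, hc, rfl⟩ := mem_image.1 hr
      exact mem_range.2 (rank_lt_card hc)
    · rw [card_range, card_image_of_injOn fun c hc d hd h => rank_inj hc hd h]
  exact mem_image.1 (h ▸ mem_range.2 hr)

theorem exists_partner {H : Finset ℤ} (hH : Even H.card) {c : ℤ} (hc : c ∈ H) :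
    ∃ d ∈ H, d ≠ c ∧ rank H d / 2 = rank H c / 2 := by
  have h1 := rank_lt_card hc
  obtain ⟨k, hk⟩ := hH
  obtain ⟨d, hd, h2⟩ := exists_rank_eq H
    -- Ranks start at 0 and are paired as 2k, 2k + 1. Evenness of `H.card` keeps the successor of an
    -- even rank in range.
    (r := if rank H c % 2 = 0 then rank H c + 1 else rank H c - 1) (by split_ifs <;> omega)
  refine ⟨d, hd, fun e => ?_, ?_⟩
  · rw [e] at h2
    split_ifs at h2 <;> omega
  · rw [h2]
    split_ifs <;> omega

theorem eq_of_rank_div_two_eq {H : Finset ℤ} {c d e : ℤ} (hd : d ∈ H)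
    (he : e ∈ H) (hcd : d ≠ c) (hce : e ≠ c) (hc : c ∈ H) (h1 : rank H d / 2 = rank H c / 2)
    (h2 : rank H e / 2 = rank H c / 2) : d = e := by
  have h3 : rank H d ≠ rank H c := fun h => hcd (rank_inj hd hc h)
  have h4 : rank H e ≠ rank H c := fun h => hce (rank_inj he hc h)
  exact rank_inj hd he (by omega)

/-- An involution without fixed points that reverses the order of two points only when it
exchanges them pairs consecutive points. -/
theorem rank_div_two_eq_of_involution {H : Finset ℤ} (f : ℤ → ℤ)
    (h : ∀ c ∈ H, f c ∈ H ∧ f (f c) = c ∧ f c ≠ c)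
    (hf : ∀ c ∈ H, ∀ d ∈ H, c < d → f d < f c → f c = d) {c : ℤ} (hc : c ∈ H) :
    rank H (f c) / 2 = rank H c / 2 := by
  -- For `e` strictly between `c` and `f c`, either `c, e` or `e, f c` is reversed by `f` without
  -- being exchanged.
  have adj : ∀ c ∈ H, ∀ e ∈ H, ¬ (c < e ∧ e < f c) := by
    rintro c hc e he ⟨h1, h2⟩
    obtain ⟨c1, c2, c3⟩ := h c hc
    obtain ⟨e1, e2, e3⟩ := h e he
    have h3 : ¬ f e < f c := fun h3 => by
      have := hf c hc e he h1 h3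
      omega
    have h4 : f e ≠ f c := fun h4 => by
      rw [h4, c2] at e2
      omega
    have := hf e he (f c) c1 h2 (by omega)
    omega
  have key : ∀ c ∈ H, c < f c → rank H (f c) / 2 = rank H c / 2 := by
    intro c hc hlt
    -- By adjacency no pair straddles `c`, so `f` acts on the elements below `c`.
    have heven : Even (rank H c) := by
      refine even_card_of_involution f fun x hx => ?_
      obtain ⟨h1, h2⟩ := mem_filter.1 hx
      obtain ⟨x1, x2, x3⟩ := h x h1
      refine ⟨mem_filter.2 ⟨x1, ?_⟩, x2, x3⟩
      have := adj x h1 c hc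
      have : f x ≠ c := fun e => by
        rw [e] at x2
        omega
      omega
    have hsucc : rank H (f c) = rank H c + 1 := by
      have : H.filter (fun x => x < f c) = insert c (H.filter fun x => x < c) := by
        ext x
        simp only [mem_filter, mem_insert]
        constructor
        · rintro ⟨h1, h2⟩
          have := adj c hc x h1
          by_cases hx : x = c
          · exact .inl hx
          · exact .inr ⟨h1, by omega⟩
        · rintro (rfl | ⟨h1, h2⟩)
          · exact ⟨hc, hlt⟩
          · exact ⟨h1, by omega⟩
      rw [rank, this, card_insert_of_notMem (by simp), rank]
    obtain ⟨k, hk⟩ := heven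
    omega
  obtain ⟨c1, c2, c3⟩ := h c hc
  rcases lt_or_gt_of_ne c3 with hlt | hlt
  · have := key (f c) c1 (by omega)
    rw [c2] at this
    exact this.symm
  · exact key c hc hlt

/-- The arcs `(-c, d)` with `c ≠ d` joining the `2k`-th and `2k+1`-st elements of `H`. -/
def crossArcs (H : Finset ℤ) : Finset (ℤ × ℤ) :=
  ((H ×ˢ H).filter fun p => p.1 ≠ p.2 ∧ rank H p.1 / 2 = rank H p.2 / 2).image fun p => (-p.1, p.2)

theorem mem_crossArcs {H : Finset ℤ} {p : ℤ × ℤ} : p ∈ crossArcs H ↔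
    -p.1 ∈ H ∧ p.2 ∈ H ∧ -p.1 ≠ p.2 ∧ rank H (-p.1) / 2 = rank H p.2 / 2 := by
  simp only [crossArcs, mem_image, mem_filter, mem_product]
  constructor
  · rintro ⟨q, ⟨⟨h1, h2⟩, h3, h4⟩, rfl⟩
    simp only [neg_neg]
    exact ⟨h1, h2, h3, h4⟩
  · rintro ⟨h1, h2, h3, h4⟩
    exact ⟨(-p.1, p.2), ⟨⟨h1, h2⟩, h3, h4⟩, by simp⟩

theorem image_snd_crossArcs {H : Finset ℤ} (hH : Even H.card) :
    (crossArcs H).image Prod.snd = H := by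
  ext c
  simp only [mem_image]
  constructor
  · rintro ⟨p, hp, rfl⟩
    exact (mem_crossArcs.1 hp).2.1
  · intro hc
    obtain ⟨d, hd, h1, h2⟩ := exists_partner hH hc
    exact ⟨(-d, c), mem_crossArcs.2 (by simp only [neg_neg]; exact ⟨hd, hc, h1, h2⟩), rfl⟩

theorem snd_injOn_crossArcs {H : Finset ℤ} {p q : ℤ × ℤ} (hp : p ∈ crossArcs H)
    (hq : q ∈ crossArcs H) (h : p.2 = q.2) : p = q := by
  obtain ⟨p1, p2, p3, p4⟩ := mem_crossArcs.1 hp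
  obtain ⟨q1, q2, q3, q4⟩ := mem_crossArcs.1 hq
  rw [← h] at q3 q4
  have := eq_of_rank_div_two_eq p1 q1 p3 q3 p2 p4 q4
  exact Prod.ext (by omega) h

theorem card_crossArcs {H : Finset ℤ} (hH : Even H.card) : (crossArcs H).card = H.card := by
  rw [← card_image_of_injOn (f := Prod.snd) fun p hp q hq h => snd_injOn_crossArcs hp hq h,
    image_snd_crossArcs hH]

/-- The reflection `(i, j) ↦ (-j, -i)`. -/
def flip (p : ℤ × ℤ) : ℤ × ℤ := (-p.2, -p.1)

@[simp] theorem flip_fst (p : ℤ × ℤ) : (flip p).1 = -p.2 := rfl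

@[simp] theorem flip_snd (p : ℤ × ℤ) : (flip p).2 = -p.1 := rfl

@[simp] theorem flip_flip (p : ℤ × ℤ) : flip (flip p) = p := by simp [flip]

theorem flip_injective : Function.Injective flip := Function.LeftInverse.injective flip_flip

theorem mem_image_flip {A : Finset (ℤ × ℤ)} {p : ℤ × ℤ} : p ∈ A.image flip ↔ flip p ∈ A := by
  rw [mem_image]
  exact ⟨by rintro ⟨q, hq, rfl⟩; rwa [flip_flip], fun h => ⟨_, h, flip_flip p⟩⟩

theorem flip_mem_crossArcs {H : Finset ℤ} {p : ℤ × ℤ} (hp : p ∈ crossArcs H) :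
    flip p ∈ crossArcs H := by
  obtain ⟨h1, h2, h3, h4⟩ := mem_crossArcs.1 hp
  rw [mem_crossArcs]
  simp only [flip_fst, flip_snd, neg_neg]
  exact ⟨h2, h1, h3.symm, h4.symm⟩

/-- The symmetric weakly noncrossing arc sets. -/
structure IsSymArcSet (s : Finset ℤ) (S : Finset (ℤ × ℤ)) : Prop where
  arcSet : IsArcSet s S
  symm : ∀ p ∈ S, flip p ∈ S ∧ p.1 ≠ -p.2
  crossing : ∀ p ∈ S, ∀ q ∈ S, p.1 < q.1 ∧ q.1 < p.2 ∧ p.2 < q.2 → p = flip q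

/-- The symmetric arc set with nonnegative part `z.1` and positive ends of arcs over `0` in `z.2`. -/
def unfoldHalf (z : Finset (ℤ × ℤ) × Finset ℤ) : Finset (ℤ × ℤ) :=
  (z.1 ∪ z.1.image flip) ∪ crossArcs z.2

/-- The nonnegative arcs, and the positive ends of the arcs over `0`. -/
def foldHalf (S : Finset (ℤ × ℤ)) : Finset (ℤ × ℤ) × Finset ℤ :=
  (S.filter fun p => 0 ≤ p.1, (S.filter fun p => p.1 < 0 ∧ 0 < p.2).image Prod.snd)

theorem mem_unfoldHalf {z : Finset (ℤ × ℤ) × Finset ℤ} {p : ℤ × ℤ} :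
    p ∈ unfoldHalf z ↔ p ∈ z.1 ∨ flip p ∈ z.1 ∨ p ∈ crossArcs z.2 := by
  rw [unfoldHalf, mem_union, mem_union, mem_image_flip, or_assoc]

section Unfold

variable {a n : ℤ} {A : Finset (ℤ × ℤ)} {H : Finset ℤ}

theorem IsHalf.pos (h : IsHalf a n (A, H)) (ha : 0 ≤ a) (h0 : (0 : ℤ) ∉ H) {c : ℤ} (hc : c ∈ H) :
    0 < c := by
  have := h.bounds hc
  have : c ≠ 0 := fun e => h0 (e ▸ hc)
  omega

/-- The description of `s` by absolute values treats both types at once: `a = 0` is type B and `a =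
1` is type D. -/
theorem IsHalf.isSymArcSet_unfoldHalf (h : IsHalf a n (A, H)) (ha : 0 ≤ a) (h0 : (0 : ℤ) ∉ H)
    {s : Finset ℤ} (hs : ∀ z, z ∈ s ↔ a ≤ |z| ∧ |z| ≤ n) :
    IsSymArcSet s (unfoldHalf (A, H)) := by
  have hA : ∀ p ∈ A, a ≤ p.1 ∧ p.1 < p.2 ∧ p.2 ≤ n := fun p hp =>
    ⟨h.le_fst hp, h.lt hp, h.snd_le hp⟩
  have hX : ∀ p ∈ crossArcs H, a ≤ -p.1 ∧ -p.1 ≤ n ∧ p.1 < 0 ∧ a ≤ p.2 ∧ p.2 ≤ n ∧ 0 < p.2 ∧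
      -p.1 ∈ H ∧ p.2 ∈ H ∧ -p.1 ≠ p.2 := fun p hp => by
    obtain ⟨h1, h2, h3, -⟩ := mem_crossArcs.1 hp
    have := h.bounds h1
    have := h.bounds h2
    have := h.pos ha h0 h1
    have := h.pos ha h0 h2
    exact ⟨by omega, by omega, by omega, by omega, by omega, by omega, h1, h2, h3⟩
  have hflip : ∀ p ∈ unfoldHalf (A, H), flip p ∈ unfoldHalf (A, H) := by
    intro p hp
    rw [mem_unfoldHalf] at hp ⊢
    rw [flip_flip]
    rcases hp with hp | hp | hp
    · exact .inr (.inl hp)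
    · exact .inl hp
    · exact .inr (.inr (flip_mem_crossArcs hp))
  have hsnd : ∀ p ∈ unfoldHalf (A, H), ∀ q ∈ unfoldHalf (A, H), p.2 = q.2 → p = q := by
    intro p hp q hq hpq
    rcases mem_unfoldHalf.1 hp with hp | hp | hp <;> rcases mem_unfoldHalf.1 hq with hq | hq | hq
    · exact h.arcSet.snd_inj p hp q hq hpq
    · have := hA p hp
      have := hA _ hq
      simp only [flip_fst, flip_snd] at this
      omega
    · exact absurd hpq (h.end_ne _ (hX q hq).2.2.2.2.2.2.2.1 p hp)
    · have := hA _ hp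
      have := hA _ hq
      simp only [flip_fst, flip_snd] at *
      omega
    · exact flip_injective (h.arcSet.fst_inj _ hp _ hq (by simp [hpq]))
    · have := hA _ hp
      have := hX _ hq
      simp only [flip_fst, flip_snd] at *
      omega
    · exact absurd hpq.symm (h.end_ne _ (hX p hp).2.2.2.2.2.2.2.1 q hq)
    · have := hA _ hq
      have := hX _ hp
      simp only [flip_fst, flip_snd] at *
      omega
    · exact snd_injOn_crossArcs hp hq hpq
  refine ⟨⟨?_, ?_, ?_, ?_, hsnd⟩, ?_, ?_⟩
  · intro p hp
    rw [hs]
    rcases mem_unfoldHalf.1 hp with hp | hp | hp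
    · have := hA p hp
      rw [abs_of_nonneg (by omega)]; omega
    · have := hA _ hp
      simp only [flip_fst, flip_snd] at this
      rw [abs_of_nonpos (by omega)]; omega
    · have := hX p hp
      rw [abs_of_neg (by omega)]; omega
  · intro p hp
    rw [hs]
    rcases mem_unfoldHalf.1 hp with hp | hp | hp
    · have := hA p hp
      rw [abs_of_nonneg (by omega)]; omega
    · have := hA _ hp
      simp only [flip_fst, flip_snd] at this
      rw [abs_of_nonpos (by omega)]; omega
    · have := hX p hp
      rw [abs_of_pos (by omega)]; omega
  · intro p hp
    rcases mem_unfoldHalf.1 hp with hp | hp | hp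
    · exact h.lt hp
    · have := h.lt hp
      simp only [flip_fst, flip_snd] at this
      omega
    · have := hX p hp
      omega
  · intro p hp q hq hpq
    -- Reflection exchanges starts and ends, so uniqueness for ends gives uniqueness for starts.
    exact flip_injective (hsnd _ (hflip p hp) _ (hflip q hq) (by simp [hpq]))
  · intro p hp
    refine ⟨hflip p hp, ?_⟩
    rcases mem_unfoldHalf.1 hp with hp | hp | hp
    · have := hA p hp
      omega
    · have := hA _ hp
      simp only [flip_fst, flip_snd] at this
      omega
    · have := hX p hp
      omega
  · intro p hp q hq hpq
    rcases mem_unfoldHalf.1 hp with hp | hp | hp <;> rcases mem_unfoldHalf.1 hq with hq | hq | hq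
    · exact absurd hpq (h.noncrossing p hp q hq)
    · have := hA p hp
      have := hA _ hq
      simp only [flip_fst, flip_snd] at this
      omega
    · have := hA p hp
      have := hX _ hq
      omega
    · have := hA _ hp
      have := hA _ hq
      simp only [flip_fst, flip_snd] at *
      omega
    · have := h.noncrossing _ hq _ hp
      simp only [flip_fst, flip_snd] at *
      omega
    · have := h.not_under _ (hX q hq).2.2.2.2.2.2.1 _ hp
      simp only [flip_fst, flip_snd] at *
      omega
    · have := h.not_under _ (hX p hp).2.2.2.2.2.2.2.1 _ hq
      omega
    · have := hA _ hq
      have := hX p hp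
      simp only [flip_fst, flip_snd] at *
      omega
    · obtain ⟨p1, p2, p3, p4⟩ := mem_crossArcs.1 hp
      obtain ⟨q1, q2, q3, q4⟩ := mem_crossArcs.1 hq
      -- The two inequalities force both arcs into the same pair of consecutive elements of `H`, so
      -- they are reflections of each other.
      have r1 := rank_lt q1 (show -q.1 < -p.1 by omega)
      have r2 := rank_lt p2 (show p.2 < q.2 by omega)
      have r3 : rank H (-p.1) ≠ rank H p.2 := fun e => p3 (rank_inj p1 p2 e)
      have r4 : rank H (-q.1) ≠ rank H q.2 := fun e => q3 (rank_inj q1 q2 e)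
      have e1 := rank_inj p1 q2 (by omega)
      have e2 := rank_inj p2 q1 (by omega)
      exact Prod.ext (by simp only [flip_fst]; omega) (by simp only [flip_snd]; omega)

theorem IsHalf.foldHalf_unfoldHalf (h : IsHalf a n (A, H)) (ha : 0 ≤ a) (h0 : (0 : ℤ) ∉ H)
    (hH : Even H.card) : foldHalf (unfoldHalf (A, H)) = (A, H) := by
  have hX : ∀ p ∈ crossArcs H, p.1 < 0 ∧ 0 < p.2 := fun p hp => by
    obtain ⟨h1, h2, -⟩ := mem_crossArcs.1 hp
    have := h.pos ha h0 h1
    have := h.pos ha h0 h2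
    omega
  refine Prod.ext ?_ ?_
  · ext p
    simp only [foldHalf, mem_filter, mem_unfoldHalf]
    constructor
    · rintro ⟨hp | hp | hp, h1⟩
      · exact hp
      · have := h.le_fst hp
        have := h.lt hp
        simp only [flip_fst, flip_snd] at *
        omega
      · have := hX p hp
        omega
    · intro hp
      have := h.le_fst hp
      exact ⟨.inl hp, by omega⟩
  · conv_rhs => rw [← image_snd_crossArcs hH]
    simp only [foldHalf]
    congr 1
    ext p
    simp only [mem_filter, mem_unfoldHalf]
    constructor
    · rintro ⟨hp | hp | hp, h1⟩
      · have := h.le_fst hp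
        omega
      · have := h.le_fst hp
        simp only [flip_fst] at *
        omega
      · exact hp
    · intro hp
      exact ⟨.inr (.inr hp), hX p hp⟩

/-- The monomial `x ^ (|S \ Cov| / 2) * y ^ (|Cov| / 2)` of a set of arcs. -/
noncomputable def sqrtWeight (S : Finset (ℤ × ℤ)) : MvPolynomial (Fin 2) ℤ :=
  MvPolynomial.X 0 ^ ((S \ S.filter fun p => p.2 = p.1 + 1).card / 2) *
    MvPolynomial.X 1 ^ ((S.filter fun p => p.2 = p.1 + 1).card / 2)

theorem IsHalf.card_filter_unfoldHalf (h : IsHalf a n (A, H)) (ha : 0 ≤ a) (h0 : (0 : ℤ) ∉ H)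
    (φ : ℤ × ℤ → Prop) [DecidablePred φ] (hφ : ∀ p, φ (flip p) ↔ φ p) :
    ((unfoldHalf (A, H)).filter φ).card =
      2 * (A.filter φ).card + ((crossArcs H).filter φ).card := by
  have hX : ∀ p ∈ crossArcs H, p.1 < 0 ∧ 0 < p.2 := fun p hp => by
    obtain ⟨h1, h2, -⟩ := mem_crossArcs.1 hp
    have := h.pos ha h0 h1
    have := h.pos ha h0 h2
    omega
  have hd1 : Disjoint A (A.image flip) := disjoint_left.2 fun p hp hq => by
    have h1 := h.le_fst hp
    have h2 := h.lt hp
    have h3 := h.le_fst (mem_image_flip.1 hq)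
    simp only [flip_fst] at h3
    omega
  have hd2 : Disjoint (A ∪ A.image flip) (crossArcs H) := disjoint_left.2 fun p hp hq => by
    have h1 := hX p hq
    rcases mem_union.1 hp with hp | hp
    · have := h.le_fst hp
      omega
    · have := h.le_fst (mem_image_flip.1 hp)
      simp only [flip_fst] at this
      omega
  rw [unfoldHalf, filter_union, filter_union,
    card_union_of_disjoint (by
      rw [← filter_union]
      exact disjoint_filter_filter hd2),
    card_union_of_disjoint (disjoint_filter_filter hd1), filter_image,
    card_image_of_injective _ flip_injective]
  simp only [hφ]
  ring

/-- Each arc of `A` is counted with its mirror image, which the halving undoes. The arcs over 0 have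
length at least 2, so they are not covers, and there are `H.card` of them. -/
theorem IsHalf.sqrtWeight_unfoldHalf (h : IsHalf a n (A, H)) (ha : 0 ≤ a) (h0 : (0 : ℤ) ∉ H)
    (hH : Even H.card) :
    sqrtWeight (unfoldHalf (A, H)) = weight A * MvPolynomial.X 0 ^ (H.card / 2) := by
  have hX : ∀ p ∈ crossArcs H, ¬ p.2 = p.1 + 1 := fun p hp => by
    obtain ⟨h1, h2, h3, -⟩ := mem_crossArcs.1 hp
    have := h.pos ha h0 h1
    have := h.pos ha h0 h2
    omega
  simp only [sqrtWeight, weight, ← filter_not]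
  rw [h.card_filter_unfoldHalf ha h0 _ (fun p => by simp only [flip_fst, flip_snd]; omega),
    h.card_filter_unfoldHalf ha h0 _ (fun p => by simp only [flip_fst, flip_snd]; omega),
    filter_true_of_mem hX, filter_false_of_mem hX, card_crossArcs hH, card_empty,
    Nat.mul_add_div two_pos, Nat.mul_add_div two_pos, pow_add]
  simp only [Nat.zero_div, add_zero]
  ring

end Unfold

namespace IsSymArcSet

variable {a n : ℤ} {s : Finset ℤ} {S : Finset (ℤ × ℤ)}

theorem isHalf_foldHalf (h : IsSymArcSet s S) (hs : ∀ z, z ∈ s ↔ a ≤ |z| ∧ |z| ≤ n) :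
    IsHalf a n (foldHalf S) := by
  have hA : ∀ p ∈ (foldHalf S).1, p ∈ S ∧ 0 ≤ p.1 := fun p hp => mem_filter.1 hp
  have hH : ∀ c ∈ (foldHalf S).2, ∃ p ∈ S, p.1 < 0 ∧ 0 < c ∧ p.2 = c := fun c hc => by
    obtain ⟨p, hp, rfl⟩ := mem_image.1 hc
    obtain ⟨h1, h2⟩ := mem_filter.1 hp
    exact ⟨p, h1, h2.1, h2.2, rfl⟩
  have hpos : ∀ z ∈ s, 0 ≤ z → z ∈ Icc a n := fun z hz h0 => by
    have := (hs z).1 hz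
    rw [abs_of_nonneg h0] at this
    exact mem_Icc.2 this
  refine ⟨⟨?_, ?_, ?_, ?_, ?_⟩, ?_, ?_, ?_, ?_⟩
  · intro p hp
    obtain ⟨h1, h2⟩ := hA p hp
    exact hpos _ (h.arcSet.fst_mem p h1) h2
  · intro p hp
    obtain ⟨h1, h2⟩ := hA p hp
    have := h.arcSet.lt p h1
    exact hpos _ (h.arcSet.snd_mem p h1) (by omega)
  · exact fun p hp => h.arcSet.lt p (hA p hp).1
  · exact fun p hp q hq => h.arcSet.fst_inj p (hA p hp).1 q (hA q hq).1
  · exact fun p hp q hq => h.arcSet.snd_inj p (hA p hp).1 q (hA q hq).1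
  · intro p hp q hq hpq
    have h1 := congrArg Prod.fst (h.crossing p (hA p hp).1 q (hA q hq).1 hpq)
    have h2 := (hA p hp).2
    simp only [flip_fst] at h1
    omega
  · intro c hc
    obtain ⟨p, hp, h1, h2, rfl⟩ := hH c hc
    exact hpos _ (h.arcSet.snd_mem p hp) h2.le
  · intro c hc p hp e
    obtain ⟨q, hq, h1, h2, h3⟩ := hH c hc
    obtain ⟨h4, h5⟩ := hA p hp
    rw [h.arcSet.snd_inj p h4 q hq (by omega)] at h5
    omega
  · intro c hc p hp e
    obtain ⟨q, hq, h1, h2, h3⟩ := hH c hc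
    obtain ⟨h4, h5⟩ := hA p hp
    have h6 := congrArg Prod.snd (h.crossing q hq p h4 (by omega))
    simp only [flip_snd] at h6
    omega

theorem zero_notMem_foldHalf : (0 : ℤ) ∉ (foldHalf S).2 := fun h => by
  obtain ⟨p, hp, h1⟩ := mem_image.1 h
  have := (mem_filter.1 hp).2
  omega

/-- The map sends the end `c` of an arc `(-d, c)` over 0 to `d`. Symmetry makes it an involution,
the ban on arcs `(-i, i)` removes fixed points, and the weak noncrossing condition controls order
reversals. -/
theorem exists_involution (h : IsSymArcSet s S) : ∃ f : ℤ → ℤ,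
    (∀ c ∈ (foldHalf S).2, (-f c, c) ∈ S ∧ f c ∈ (foldHalf S).2 ∧ f (f c) = c ∧ f c ≠ c) ∧
      ∀ c ∈ (foldHalf S).2, ∀ d ∈ (foldHalf S).2, c < d → f d < f c → f c = d := by
  have hH : ∀ c, c ∈ (foldHalf S).2 ↔ ∃ d, (-d, c) ∈ S ∧ 0 < d ∧ 0 < c := fun c => by
    simp only [foldHalf, mem_image, mem_filter]
    constructor
    · rintro ⟨p, ⟨h1, h2, h3⟩, rfl⟩
      exact ⟨-p.1, by rwa [neg_neg], by omega, h3⟩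
    · rintro ⟨d, h1, h2, h3⟩
      exact ⟨(-d, c), ⟨h1, by simpa using h2, h3⟩, rfl⟩
  choose! f hf using fun c hc => (hH c).1 hc
  have hsymm : ∀ c ∈ (foldHalf S).2, (-c, f c) ∈ S := fun c hc => by
    simpa [flip] using (h.symm _ (hf c hc).1).1
  have hmem : ∀ c ∈ (foldHalf S).2, f c ∈ (foldHalf S).2 := fun c hc =>
    (hH _).2 ⟨c, hsymm c hc, (hf c hc).2.2, (hf c hc).2.1⟩
  refine ⟨f, fun c hc => ⟨(hf c hc).1, hmem c hc, ?_, fun e => ?_⟩, fun c hc d hd h1 h2 => ?_⟩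
  · have := congrArg Prod.fst (h.arcSet.snd_inj _ (hsymm c hc) _ (hf _ (hmem c hc)).1 rfl)
    simp only at this
    omega
  · have := (h.symm _ (hf c hc).1).2
    simp only at this
    omega
  · have h3 := (hf c hc).2
    have h4 := (hf d hd).2
    have := congrArg Prod.fst (h.crossing _ (hf c hc).1 _ (hf d hd).1 (by simp only; omega))
    simp only [flip_fst] at this
    omega

theorem even_card_foldHalf (h : IsSymArcSet s S) : Even (foldHalf S).2.card := by
  obtain ⟨f, hf, -⟩ := h.exists_involution
  exact even_card_of_involution f fun c hc => (hf c hc).2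

theorem mem_crossArcs_foldHalf (h : IsSymArcSet s S) {p : ℤ × ℤ} :
    p ∈ crossArcs (foldHalf S).2 ↔ p ∈ S ∧ p.1 < 0 ∧ 0 < p.2 := by
  obtain ⟨f, hf, hf2⟩ := h.exists_involution
  have hrank : ∀ {c}, c ∈ (foldHalf S).2 → _ := fun {c} hc =>
    rank_div_two_eq_of_involution f (fun c hc => (hf c hc).2) hf2 hc
  have hpos : ∀ c ∈ (foldHalf S).2, 0 < c := fun c hc => by
    obtain ⟨p, hp, rfl⟩ := mem_image.1 hc
    exact (mem_filter.1 hp).2.2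
  rw [mem_crossArcs]
  constructor
  · rintro ⟨h1, h2, h3, h4⟩
    obtain ⟨k1, k2, k3, k4⟩ := hf _ h2
    have := eq_of_rank_div_two_eq h1 k2 h3 k4 h2 h4 (hrank h2)
    have h5 := hpos _ h1
    refine ⟨?_, by omega, hpos _ h2⟩
    rwa [← this, neg_neg] at k1
  · rintro ⟨h1, h2, h3⟩
    have hp2 : p.2 ∈ (foldHalf S).2 := mem_image.2 ⟨p, mem_filter.2 ⟨h1, h2, h3⟩, rfl⟩
    obtain ⟨k1, k2, k3, k4⟩ := hf _ hp2
    have : p.1 = -f p.2 := congrArg Prod.fst (h.arcSet.snd_inj _ h1 _ k1 rfl)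
    rw [this, neg_neg]
    exact ⟨k2, hp2, k4, hrank hp2⟩

theorem unfoldHalf_foldHalf (h : IsSymArcSet s S) : unfoldHalf (foldHalf S) = S := by
  ext p
  rw [mem_unfoldHalf, h.mem_crossArcs_foldHalf]
  simp only [foldHalf, mem_filter, flip_fst]
  constructor
  · rintro (hp | hp | hp)
    · exact hp.1
    · simpa using (h.symm _ hp.1).1
    · exact hp.1
  · intro hp
    by_cases h1 : 0 ≤ p.1
    · exact .inl ⟨hp, h1⟩
    by_cases h2 : 0 < p.2
    · exact .inr (.inr ⟨hp, by omega, h2⟩)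
    · exact .inr (.inl ⟨(h.symm p hp).1, by omega⟩)

end IsSymArcSet

open scoped Classical in
theorem sum_symArcSets {a n : ℤ} (ha : 0 ≤ a) {s : Finset ℤ}
    (hs : ∀ z, z ∈ s ↔ a ≤ |z| ∧ |z| ≤ n) :
    ∑ S ∈ (arcSets s).filter (IsSymArcSet s), sqrtWeight S =
      ∑ z ∈ (halves a n).filter (fun z => (0 : ℤ) ∉ z.2),
        if Even z.2.card then weight z.1 * MvPolynomial.X 0 ^ (z.2.card / 2) else 0 := by
  rw [← sum_filter]
  refine sum_bij' (fun S _ => foldHalf S) (fun z _ => unfoldHalf z) ?_ ?_ ?_ ?_ ?_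
  · intro S hS
    have h := (mem_filter.1 hS).2
    exact mem_filter.2 ⟨mem_filter.2 ⟨mem_halves.2 (h.isHalf_foldHalf hs),
      IsSymArcSet.zero_notMem_foldHalf⟩, h.even_card_foldHalf⟩
  · intro z hz
    simp only [mem_filter, mem_halves] at hz
    have h := hz.1.1.isSymArcSet_unfoldHalf ha hz.1.2 hs
    exact mem_filter.2 ⟨mem_arcSets.2 h.arcSet, h⟩
  · intro S hS
    exact (mem_filter.1 hS).2.unfoldHalf_foldHalf
  · intro z hz
    simp only [mem_filter, mem_halves] at hz
    exact hz.1.1.foldHalf_unfoldHalf ha hz.1.2 hz.2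
  · intro S hS
    have h := (mem_filter.1 hS).2
    conv_lhs => rw [← h.unfoldHalf_foldHalf]
    exact (h.isHalf_foldHalf hs).sqrtWeight_unfoldHalf ha IsSymArcSet.zero_notMem_foldHalf
      h.even_card_foldHalf

end SetPart

/-! ### Trinomial coefficients and the closed forms. -/

namespace SetPart
open Finset

section Trinomial

variable {R : Type*} [CommRing R]

/-- The coefficient of `t ^ h` in the Laurent polynomial `(t + b + x / t) ^ n`. -/
def trinomial (b x : R) : ℕ → ℤ → R
  | 0, h => if h = 0 then 1 else 0
  | n + 1, h => trinomial b x n (h - 1) + b * trinomial b x n h + x * trinomial b x n (h + 1)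

theorem trinomial_succ (b x : R) (n : ℕ) (h : ℤ) : trinomial b x (n + 1) h =
    trinomial b x n (h - 1) + b * trinomial b x n h + x * trinomial b x n (h + 1) := rfl

theorem trinomial_eq_zero (b x : R) {n : ℕ} {h : ℤ} (hn : n < h) : trinomial b x n h = 0 := by
  induction n generalizing h with
  | zero => exact if_neg (by simp at hn; omega)
  | succ n ih =>
    push_cast at hn
    rw [trinomial_succ, ih (by omega), ih (by omega), ih (by omega)]
    ring

/-- The substitution t ↦ x/t fixes t + b + x/t. -/
theorem trinomial_neg (b x : R) (n h : ℕ) :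
    trinomial b x n (-(h : ℤ)) = x ^ h * trinomial b x n h := by
  induction n generalizing h with
  | zero =>
    cases h with
    | zero => simp
    | succ k =>
      rw [trinomial, trinomial, if_neg (by omega), if_neg (by omega), mul_zero]
  | succ n ih =>
    cases h with
    | zero => simp
    | succ k =>
      have h1 := ih k
      have h2 := ih (k + 1)
      have h3 := ih (k + 2)
      push_cast at h2 h3 ⊢
      rw [trinomial_succ, trinomial_succ, show -((k : ℤ) + 1) - 1 = -(k + 2) by ring,
        show -((k : ℤ) + 1) + 1 = -k by ring, show (k : ℤ) + 1 - 1 = k by ring,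
        show (k : ℤ) + 1 + 1 = k + 2 by ring, h1, h2, h3]
      ring

/-- The derivative of `(t + b + x / t) ^ (n + 1)`, compared coefficientwise. -/
theorem mul_trinomial_succ (b x : R) (n : ℕ) (h : ℤ) : h * trinomial b x (n + 1) h =
    (n + 1) * (trinomial b x n (h - 1) - x * trinomial b x n (h + 1)) := by
  induction n generalizing h with
  | zero =>
    simp only [trinomial]
    by_cases h0 : h = 0
    · subst h0
      simp
    by_cases h1 : h = 1
    · subst h1
      simp
    by_cases h2 : h = -1
    · subst h2
      simp
    rw [if_neg (by omega), if_neg h0, if_neg (by omega)]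
    ring
  | succ n ih =>
    have h1 := ih (h - 1)
    have h2 := ih h
    have h3 := ih (h + 1)
    have e1 := trinomial_succ b x n (h - 1)
    have e3 := trinomial_succ b x n (h + 1)
    rw [trinomial_succ b x (n + 1)]
    simp only [sub_add_cancel, add_sub_cancel_right] at h1 h2 h3 e1 e3
    push_cast at *
    -- Writing h as (h ∓ 1) ± 1 in the outer terms leaves one extra copy of T_{n+1}(h - 1) - x
    -- T_{n+1}(h + 1), which raises the factor n + 1 to n + 2.
    linear_combination h1 + b * h2 + x * h3 - (n + 1) * (e1 - x * e3)

end Trinomial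

/-- The trinomial coefficients with `b = 1 + y`. -/
noncomputable abbrev tri (n : ℕ) (h : ℤ) : MvPolynomial (Fin 2) ℤ :=
  trinomial (1 + MvPolynomial.X 1) (MvPolynomial.X 0) n h

/-- Reflection principle: both sides satisfy the same recursion in `m`, and the right side vanishes
at h = -1. -/
theorem halfSum_eq_tri (n : ℤ) (m h : ℕ) :
    halfSum (n - m) n h = tri m h - MvPolynomial.X 0 * tri m (h + 2) := by
  induction m generalizing h with
  | zero =>
    rw [Nat.cast_zero, sub_zero, halfSum_self]
    simp only [tri, trinomial, Int.natCast_eq_zero]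
    rw [if_neg (show ¬ (h : ℤ) + 2 = 0 by omega)]
    ring
  | succ m ih =>
    have e : n - ((m + 1 : ℕ) : ℤ) + 1 = n - m := by
      push_cast
      ring
    cases h with
    | zero =>
      -- The boundary condition T_m(-1) = x T_m(1) accounts for the term missing from the recursion
      -- at h = 0.
      have h1 := trinomial_neg (1 + MvPolynomial.X 1) (MvPolynomial.X 0 : MvPolynomial (Fin 2) ℤ) m 1
      rw [halfSum_succ_zero (by omega), e, ih, ih]
      simp only [tri]
      rw [trinomial_succ, trinomial_succ]
      norm_num at h1 ⊢
      linear_combination -h1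
    | succ k =>
      rw [halfSum_succ_succ (by omega), e, ih, ih, ih]
      simp only [tri]
      rw [trinomial_succ, trinomial_succ]
      push_cast
      rw [show (k : ℤ) + 1 - 1 = k by ring, show (k : ℤ) + 1 + 1 = k + 2 by ring,
        show (k : ℤ) + 1 + 2 - 1 = k + 2 by ring, show (k : ℤ) + 1 + 2 + 1 = k + 2 + 2 by ring]
      ring

theorem card_le_of_mem_halves {a n : ℤ} {z : Finset (ℤ × ℤ) × Finset ℤ} (hz : z ∈ halves a n) :
    z.2.card ≤ (n + 1 - a).toNat := by
  rw [← Int.card_Icc]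
  exact card_le_card (mem_halves.1 hz).subset

theorem sum_halves_even (n : ℤ) (m : ℕ) :
    (∑ z ∈ (halves (n - m) n).filter (fun z => n - m ∉ z.2),
      if Even z.2.card then weight z.1 * MvPolynomial.X 0 ^ (z.2.card / 2) else 0) = tri m 0 := by
  have h1 : ∀ z ∈ (halves (n - m) n).filter (fun z => n - m ∉ z.2),
      (if Even z.2.card then weight z.1 * MvPolynomial.X 0 ^ (z.2.card / 2) else 0) =
        ∑ k ∈ range (m + 2),
          MvPolynomial.X 0 ^ k * if z.2.card = 2 * k then weight z.1 else 0 := by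
    intro z hz
    have hle := card_le_of_mem_halves (mem_filter.1 hz).1
    split_ifs with he
    · obtain ⟨j, hj⟩ := he
      rw [sum_eq_single_of_mem j (mem_range.2 (by omega))
        (fun k _ hk => by rw [if_neg (by omega), mul_zero]), if_pos (by omega), mul_comm,
        show z.2.card / 2 = j by omega]
    · symm
      refine sum_eq_zero fun k _ => ?_
      rw [if_neg (fun e => he ⟨k, by omega⟩), mul_zero]
  have h2 : ∀ k : ℕ, MvPolynomial.X 0 ^ k * halfSum (n - m) n (2 * k) =
      MvPolynomial.X 0 ^ k * tri m (2 * k : ℕ) -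
        MvPolynomial.X 0 ^ (k + 1) * tri m (2 * (k + 1) : ℕ) := fun k => by
    rw [halfSum_eq_tri]
    push_cast
    rw [show 2 * ((k : ℤ) + 1) = 2 * k + 2 by ring]
    ring
  rw [sum_congr rfl h1, sum_comm]
  simp only [← mul_sum]
  refine (sum_congr rfl fun k _ => h2 k).trans ?_
  -- The sum telescopes to its first term: the last one is T_m at 2(m + 2), beyond the degree m.
  rw [sum_range_sub' (fun k => MvPolynomial.X 0 ^ k * tri m (2 * k : ℕ)), tri, tri,
    trinomial_eq_zero (h := ((2 * (m + 2) : ℕ) : ℤ)) _ _ (by push_cast; omega)]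
  simp

/-- The shift by 1 in the cardinality anticipates marking the first point, as type D requires. -/
theorem sum_halves_odd (n : ℤ) (m : ℕ) :
    (∑ z ∈ (halves (n - m) n).filter (fun z => n - m ∉ z.2),
      if Even (z.2.card + 1) then weight z.1 * MvPolynomial.X 0 ^ ((z.2.card + 1) / 2) else 0) =
      MvPolynomial.X 0 * tri m 1 := by
  have h1 : ∀ z ∈ (halves (n - m) n).filter (fun z => n - m ∉ z.2),
      (if Even (z.2.card + 1) then weight z.1 * MvPolynomial.X 0 ^ ((z.2.card + 1) / 2) else 0) =
        ∑ k ∈ range (m + 2),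
          MvPolynomial.X 0 ^ (k + 1) * if z.2.card = 2 * k + 1 then weight z.1 else 0 := by
    intro z hz
    have hle := card_le_of_mem_halves (mem_filter.1 hz).1
    split_ifs with he
    · obtain ⟨j, hj⟩ := he
      rw [sum_eq_single_of_mem (j - 1) (mem_range.2 (by omega))
        (fun k _ hk => by rw [if_neg (by omega), mul_zero]), if_pos (by omega), mul_comm,
        show (z.2.card + 1) / 2 = j - 1 + 1 by omega]
    · symm
      refine sum_eq_zero fun k _ => ?_
      rw [if_neg (fun e => he ⟨k + 1, by omega⟩), mul_zero]
  have h2 : ∀ k : ℕ, MvPolynomial.X 0 ^ (k + 1) * halfSum (n - m) n (2 * k + 1) =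
      MvPolynomial.X 0 ^ (k + 1) * tri m (2 * k + 1 : ℕ) -
        MvPolynomial.X 0 ^ (k + 1 + 1) * tri m (2 * (k + 1) + 1 : ℕ) := fun k => by
    rw [halfSum_eq_tri]
    push_cast
    rw [show 2 * ((k : ℤ) + 1) + 1 = 2 * k + 1 + 2 by ring]
    ring
  rw [sum_congr rfl h1, sum_comm]
  simp only [← mul_sum]
  refine (sum_congr rfl fun k _ => h2 k).trans ?_
  rw [sum_range_sub' (fun k => MvPolynomial.X 0 ^ (k + 1) * tri m (2 * k + 1 : ℕ)), tri, tri,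
    trinomial_eq_zero (h := ((2 * (m + 2) + 1 : ℕ) : ℤ)) _ _ (by push_cast; omega)]
  simp

theorem cat_succ (n : ℕ) :
    cat (n + 1) = tri n 0 - MvPolynomial.X 0 * tri n 2 := by
  classical
  have h1 : cat (n + 1) = ∑ P ∈ univ.filter (fun P : Finpartition (groundA (n + 1)) =>
      ∀ p ∈ arcs P, ∀ q ∈ arcs P, ¬ (p.1 < q.1 ∧ q.1 < p.2 ∧ p.2 < q.2)), weight (arcs P) := by
    rw [cat, ncA]
    refine sum_congr ?_ fun P _ => rfl
    ext P
    simp only [mem_filter]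
    rfl
  rw [h1, sum_finpartition (groundA (n + 1))
    (fun A => ∀ p ∈ A, ∀ q ∈ A, ¬ (p.1 < q.1 ∧ q.1 < p.2 ∧ p.2 < q.2)) weight]
  have h2 := halfSum_eq_tri ((n + 1 : ℕ) : ℤ) n 0
  rw [show ((n + 1 : ℕ) : ℤ) - n = 1 by push_cast; ring] at h2
  simp only [Nat.cast_zero, zero_add] at h2
  rw [← h2, halfSum, ← sum_filter]
  refine sum_bij' (fun A _ => (A, ∅)) (fun z _ => z.1) ?_ ?_ ?_ ?_ ?_
  · intro A hA
    simp only [mem_filter, mem_arcSets, mem_halves] at hA ⊢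
    exact ⟨⟨⟨hA.1, hA.2, by simp, by simp, by simp⟩, by simp⟩, by simp⟩
  · intro z hz
    simp only [mem_filter, mem_arcSets, mem_halves] at hz ⊢
    exact ⟨hz.1.1.arcSet, hz.1.1.noncrossing⟩
  · intro A _
    rfl
  · intro z hz
    exact Prod.ext rfl (card_eq_zero.1 (mem_filter.1 hz).2).symm
  · intro A _
    rfl

theorem sum_symmetric_partitions {a n : ℤ} (ha : 0 ≤ a) {s : Finset ℤ}
    (hs : ∀ z, z ∈ s ↔ a ≤ |z| ∧ |z| ≤ n) :
    ∑ P ∈ univ.filter (fun P : Finpartition s => IsSymmetric P ∧ IsSymNoncrossing P),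
        MvPolynomial.X 0 ^ ((arcs P \ covs P).card / 2) * MvPolynomial.X 1 ^ ((covs P).card / 2) =
      ∑ z ∈ (halves a n).filter (fun z => (0 : ℤ) ∉ z.2),
        if Even z.2.card then weight z.1 * (MvPolynomial.X 0 : MvPolynomial (Fin 2) ℤ) ^ (z.2.card / 2)
        else 0 := by
  classical
  rw [← sum_symArcSets ha hs, ← sum_finpartition s (IsSymArcSet s) sqrtWeight]
  refine sum_congr ?_ fun P _ => rfl
  ext P
  simp only [mem_filter, mem_univ, true_and]
  exact ⟨fun h => ⟨isArcSet_arcs P, h.1, h.2⟩, fun h => ⟨h.symm, h.crossing⟩⟩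

theorem catB_eq (n : ℕ) : catB n = tri n 0 := by
  rw [catB, ncB, sum_symmetric_partitions (a := 0) (n := n) le_rfl
    (fun z => by rw [groundB, mem_Icc, abs_le]; simp), ← sum_halves_even n n]
  rw [sub_self]

/-- Unlike 0 in type B, the first point 1 may be the end of an arc over 0. The two terms correspond
to 1 being unmarked and marked. -/
theorem catD_succ (n : ℕ) : catD (n + 1) = tri n 0 + MvPolynomial.X 0 * tri n 1 := by
  have e : ((n + 1 : ℕ) : ℤ) - n = 1 := by
    push_cast
    ring
  have h1 := sum_halves_even ((n + 1 : ℕ) : ℤ) n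
  have h2 := sum_halves_odd ((n + 1 : ℕ) : ℤ) n
  rw [e] at h1 h2
  rw [catD, ncD, sum_symmetric_partitions (a := 1) (n := (n + 1 : ℕ)) zero_le_one
    (fun z => by rw [groundD, groundB, mem_erase, mem_Icc, abs_le]; exact and_congr_left' ⟨Int.one_le_abs, fun h e => by simp [e] at h⟩),
    filter_true_of_mem, ← sum_filter_add_sum_filter_not _ (fun z => (1 : ℤ) ∉ z.2), h1, ← h2]
  · simp only [not_not]
    rw [sum_halves_mem (by push_cast; omega)]
    congr 1
    refine sum_congr rfl fun z hz => ?_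
    simp only [card_insert_of_notMem (mem_filter.1 hz).2]
  · intro z hz h0
    have := (mem_halves.1 hz).bounds h0
    omega

end SetPart

theorem corollary6p5 (n : ℕ) :
    SetPart.catB (n + 1) =
        (MvPolynomial.X 1 + 1) * SetPart.catB n
          + 2 * (n : MvPolynomial (Fin 2) ℤ) * MvPolynomial.X 0 * SetPart.cat n ∧
      SetPart.catD (n + 1) =
        SetPart.catB n + (n : MvPolynomial (Fin 2) ℤ) * MvPolynomial.X 0 * SetPart.cat n := by
  have key : (n : MvPolynomial (Fin 2) ℤ) * SetPart.cat n = SetPart.tri n 1 := by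
    cases n with
    -- The value of `cat 0` is irrelevant: the factor n is 0, and so is T_0(1).
    | zero => simp [SetPart.tri, SetPart.trinomial]
    | succ m =>
      have := SetPart.mul_trinomial_succ (1 + MvPolynomial.X 1)
        (MvPolynomial.X 0 : MvPolynomial (Fin 2) ℤ) m 1
      rw [SetPart.cat_succ]
      norm_num at this ⊢
      exact this.symm
  have hneg := SetPart.trinomial_neg (1 + MvPolynomial.X 1)
    (MvPolynomial.X 0 : MvPolynomial (Fin 2) ℤ) n 1
  rw [SetPart.catD_succ, SetPart.catB_eq, SetPart.catB_eq, SetPart.tri, SetPart.trinomial_succ]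
  norm_num at hneg ⊢
  constructor
  · linear_combination hneg - 2 * MvPolynomial.X 0 * key
  · linear_combination -MvPolynomial.X 0 * key
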